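/- **Theorem (expansion theorem for the $i\varepsilon$-regularized Minkowski vacuum).** Let $\varepsilon>0$ and $m\ge 0$. Write $kx=k^0x^0-\vec k\cdot\vec x$ on $\mathbb R^{1,3}$, $\omega(\vec k)=\sqrt{m^2+|\vec k|^2}$, let $\gamma^0,\dots,\gamma^3$ be the Dirac matrices (in the Dirac representation) and let $d\sigma_m=\delta(k^2-m^2)\,\Theta(-k^0)\,d^4k$ be the image of the measure $d^3k/(2\omega(\vec k))$ under $\vec k\mapsto(-\omega(\vec k),\vec k)$. Let $\mathcal H$ be the Hilbert space of negative-energy solutions of the Dirac equation, that is, of the spinor functions $u$ on the lower mass shell with $(k_\mu\gamma^\mu-m)u(k)=0$ and with finite norm for the scalar product $$\langle u|w\rangle=\int \frac{u(k)^\dagger w(k)}{(2\pi)^4\,2|k^0|}\,d\sigma_m(k)$$ (in position space this is $2\pi\int_{\mathbb R^3}\psi_u^\dagger\psi_w\,d^3x$). For $x\in\mathbb R^{1,3}$ let $$\Psi(x):\mathcal H\to\mathbb C^4,\qquad \Psi(x)u=\int \frac{d\sigma_m(k)}{(2\pi)^4}\;u(k)\,e^{\frac12\varepsilon k^0}e^{-ikx},$$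 and for a bounded operator $A:\mathcal H\to\mathbb C^4$ let $A^*:\mathbb C^4\to\mathcal H$ be its adjoint with respect to the spin inner product, $\langle A^*\phi|u\rangle=\phi^\dagger\gamma^0 (Au)$. *CFS current.* For an operator $P$ on $\mathbb C^4$ let $P^*=\gamma^0P^\dagger\gamma^0$ and let $\mathcal L(P)=\frac18\sum_{i,j=1}^4(|\lambda_i|-|\lambda_j|)^2$, where $\lambda_1,\dots,\lambda_4$ are the eigenvalues of $PP^*$ counted with algebraic multiplicity. A perturbation is given by a vector field $\mathbf v$ on spacetime of the form $\mathbf v(y)=-(D_{\mathbf v}\Psi(y))^*\Psi(y)-\Psi(y)^*D_{\mathbf v}\Psi(y)$ with bounded operators $D_{\mathbf v}\Psi(y):\mathcal H\to\mathbb C^4$. Put $\Psi_\tau=\Psi+\tau D_{\mathbf v}\Psi$ and $P_\tau(x,y)=-\Psi_\tau(x)\Psi_\tau(y)^*$, and let $Q_\tau(x,y)$ be the kernel of the first variation of the Lagrangian at $P_\tau(x,y)$: for every operator $\delta P$ on $\mathbb C^4$, $$\tfrac{d}{ds}\big|_{s=0}\,\mathcal L\big(P_\tau(x,y)+s\,\delta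 P\big)=2\,\mathrm{Re}\,\mathrm{tr}\big[Q_\tau(x,y)\,(\delta P)^*\big].$$ For $\mathfrak r\in\mathbb R$ the CFS current at $x$ is the bounded operator $J_x(\mathbf v):\mathcal H\to\mathbb C^4$, $$J_x(\mathbf v)u=\frac{d}{d\tau}\Big|_{\tau=0}\int_{\mathbb R^{1,3}}Q_\tau(x,y)\Psi(y)u\,d^4y+\int_{\mathbb R^{1,3}}Q_0(x,y)\,D_{\mathbf v}\Psi(y)u\,d^4y-\mathfrak r\,D_{\mathbf v}\Psi(x)u .$$ It is said to exist if there is a bounded operator with this property and, for all $\tau$ in a neighborhood of $0$, $Q_\tau(x,y)$ exists for almost every $y$, and for every $u\in\mathcal H$ the integrals converge absolutely for all small $\tau$ and the $\tau$-derivative exists. *Claim.* The map $y\mapsto\Psi(y)^*$ is smooth from $\mathbb R^{1,3}$ to the bounded operators $\mathbb C^4\to\mathcal H$. Moreover, for every $\mathfrak r\in\mathbb R$, every $x\in\mathbb R^{1,3}$ and every perturbation $\mathbf v$ whose CFS current $J_x(\mathbf v)$ exists, the following are equivalent: 1. $J_x(\mathbf v)=0$; 2. $J_x(\mathbf v)\,\partial_{\mu_1}\cdots\partial_{\mu_n}\Psi(x)^*=0$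 for all $n\in\mathbb N_0$ and all $\mu_1,\dots,\mu_n\in\{0,1,2,3\}$. -/

import Mathlib

open MeasureTheory Filter Topology
open scoped ENNReal NNReal ContDiff

noncomputable section

namespace MinkowskiCFS

/-- Minkowski space `ℝ^{1,3}` (and its momentum space), coordinates `0,1,2,3`, signature `+ - - -`. -/
abbrev Spacetime : Type := Fin 4 → ℝ

/-- The spinor space `ℂ⁴` (every spin space of the regularized vacuum is identified with it). -/
abbrev Spinor : Type := EuclideanSpace ℂ (Fin 4)

/-- The Dirac matrices `γ⁰, γ¹, γ², γ³` in the Dirac representation. -/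
def gamma : Fin 4 → Matrix (Fin 4) (Fin 4) ℂ :=
  ![!![1, 0, 0, 0; 0, 1, 0, 0; 0, 0, -1, 0; 0, 0, 0, -1],
    !![0, 0, 0, 1; 0, 0, 1, 0; 0, -1, 0, 0; -1, 0, 0, 0],
    !![0, 0, 0, -Complex.I; 0, 0, Complex.I, 0; 0, Complex.I, 0, 0; -Complex.I, 0, 0, 0],
    !![0, 0, 1, 0; 0, 0, 0, -1; -1, 0, 0, 0; 0, 1, 0, 0]]

/-- The Minkowski product `k x = k⁰x⁰ - k¹x¹ - k²x² - k³x³`. -/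
def mink (k x : Spacetime) : ℝ := k 0 * x 0 - k 1 * x 1 - k 2 * x 2 - k 3 * x 3

/-- The Feynman slash `k_μ γ^μ`. -/
def slash (k : Spacetime) : Matrix (Fin 4) (Fin 4) ℂ :=
  (k 0 : ℂ) • gamma 0 - (k 1 : ℂ) • gamma 1 - (k 2 : ℂ) • gamma 2 - (k 3 : ℂ) • gamma 3

/-- The symbol `k_μ γ^μ - m` of the Dirac equation, acting on spinors. -/
def diracSymbol (m : ℝ) (k : Spacetime) : Spinor →L[ℂ] Spinor :=
  Matrix.toEuclideanCLM (n := Fin 4) (𝕜 := ℂ)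
    (slash k - (m : ℂ) • (1 : Matrix (Fin 4) (Fin 4) ℂ))

/-- The relativistic energy `ω(p) = √(m² + |p|²)`. -/
def energy (m : ℝ) (p : Fin 3 → ℝ) : ℝ := Real.sqrt (m ^ 2 + (p 0 ^ 2 + p 1 ^ 2 + p 2 ^ 2))

/-- The point `(-ω(p), p)` of the lower mass shell. -/
def lowerShell (m : ℝ) (p : Fin 3 → ℝ) : Spacetime := ![-energy m p, p 0, p 1, p 2]

/-- The measure `δ(k² - m²) Θ(-k⁰) d⁴k`, that is, the image of `d³p / (2 ω(p))` on the lower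
mass shell. -/
def shellMeasure (m : ℝ) : Measure Spacetime :=
  ((volume : Measure (Fin 3 → ℝ)).withDensity
    (fun p => ENNReal.ofReal (1 / (2 * energy m p)))).map (lowerShell m)

/-- The measure defining the scalar product of negative energy solutions. For
`ψ(x) = ∫ d⁴k/(2π)⁴ u(k) δ(k² - m²) Θ(-k⁰) e^{-ikx}` Plancherel's formula gives
`2π ∫_{ℝ³} ψ(t,x)† ψ(t,x) d³x = ∫ |u(k)|² δ(k² - m²) Θ(-k⁰) d⁴k / ((2π)⁴ 2|k⁰|)`. -/
def stateMeasure (m : ℝ) : Measure Spacetime :=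
  (shellMeasure m).withDensity (fun k => ENNReal.ofReal (1 / ((2 * Real.pi) ^ 4 * (2 * |k 0|))))

/-- The solutions of `(k_μ γ^μ - m) u(k) = 0` on the lower mass shell, as a subspace of `L²`. -/
def seaSubmodule (m : ℝ) : Submodule ℂ (Lp Spinor 2 (stateMeasure m)) where
  carrier := {u | ∀ᵐ k ∂(stateMeasure m), diracSymbol m k (u k) = 0}
  zero_mem' := by
    change ∀ᵐ k ∂(stateMeasure m),
      diracSymbol m k ((0 : Lp Spinor 2 (stateMeasure m)) k) = 0
    filter_upwards [Lp.coeFn_zero Spinor 2 (stateMeasure m)] with k hk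
    rw [hk, Pi.zero_apply, map_zero]
  add_mem' := by
    intro u v hu hv
    change ∀ᵐ k ∂(stateMeasure m), diracSymbol m k ((u + v) k) = 0
    filter_upwards [hu, hv, Lp.coeFn_add u v] with k h1 h2 h3
    rw [h3, Pi.add_apply, map_add, h1, h2, add_zero]
  smul_mem' := by
    intro c u hu
    change ∀ᵐ k ∂(stateMeasure m), diracSymbol m k ((c • u) k) = 0
    filter_upwards [hu, Lp.coeFn_smul c u] with k h1 h3
    rw [h3, Pi.smul_apply, map_smul, h1, smul_zero]

/-- The Hilbert space: the completion of the negative energy solutions of the Dirac equation. -/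
abbrev Sea (m : ℝ) : Type := seaSubmodule m

lemma isClosed_seaSubmodule (m : ℝ) :
    IsClosed (seaSubmodule m : Set (Lp Spinor 2 (stateMeasure m))) := by
  apply IsSeqClosed.isClosed
  intro u v hu huv
  have h1 := tendstoInMeasure_of_tendsto_Lp huv
  obtain ⟨ns, -, hns⟩ := h1.exists_seq_tendsto_ae
  have h2 : ∀ᵐ k ∂(stateMeasure m), ∀ n, diracSymbol m k (u n k) = 0 := ae_all_iff.2 hu
  change ∀ᵐ k ∂(stateMeasure m), diracSymbol m k (v k) = 0
  filter_upwards [hns, h2] with k hk h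
  have h3 := ((diracSymbol m k).continuous.tendsto (v k)).comp hk
  refine tendsto_nhds_unique h3 ?_
  have : (diracSymbol m k) ∘ (fun i => (u (ns i)) k) = fun _ => 0 := by
    funext i; exact h (ns i)
  rw [this]
  exact tendsto_const_nhds

instance instCompleteSea (m : ℝ) : CompleteSpace (Sea m) :=
  (isClosed_seaSubmodule m).completeSpace_coe

/-! ### The `iε`-regularized wave evaluation operator -/

/-- The factor `(2π)⁻⁴ e^{ε k⁰ / 2} e^{-ikx}`. -/
def planeWave (ε : ℝ) (x k : Spacetime) : ℂ :=
  ((2 * Real.pi : ℂ) ^ 4)⁻¹ * Complex.exp (ε * k 0 / 2) * Complex.exp (-Complex.I * mink k x)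

/-- `Ψ(x) u = ∫ d⁴k/(2π)⁴ u(k) δ(k² - m²) Θ(-k⁰) e^{ε k⁰ / 2} e^{-ikx}`. -/
def waveEvalFun (ε m : ℝ) (x : Spacetime) (u : Sea m) : Spinor :=
  ∫ k, planeWave ε x k • (u : Lp Spinor 2 (stateMeasure m)) k ∂(shellMeasure m)

lemma energy_nonneg (m : ℝ) (p : Fin 3 → ℝ) : 0 ≤ energy m p := Real.sqrt_nonneg _

lemma measurable_energy (m : ℝ) : Measurable (energy m) := by
  unfold energy; fun_prop

lemma measurable_lowerShell (m : ℝ) : Measurable (lowerShell m) := by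
  rw [measurable_pi_iff]
  intro i
  have := measurable_energy m
  fin_cases i <;> simp [lowerShell] <;> fun_prop

lemma measurable_planeWave (ε : ℝ) (x : Spacetime) : Measurable (planeWave ε x) := by
  unfold planeWave mink; fun_prop

lemma energy_pos_ae (m : ℝ) : ∀ᵐ p ∂(volume : Measure (Fin 3 → ℝ)), 0 < energy m p := by
  have h : ∀ᵐ p ∂(volume : Measure (Fin 3 → ℝ)), p ∉ ({0} : Set (Fin 3 → ℝ)) :=
    measure_eq_zero_iff_ae_notMem.1 (measure_singleton _)
  filter_upwards [h] with p hp
  apply Real.sqrt_pos.2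
  have h0 : 0 ≤ m ^ 2 + (p 0 ^ 2 + p 1 ^ 2 + p 2 ^ 2) := by positivity
  refine lt_of_le_of_ne h0 (fun h1 => hp ?_)
  have e0 : p 0 = 0 := by nlinarith [sq_nonneg m, sq_nonneg (p 0), sq_nonneg (p 1), sq_nonneg (p 2)]
  have e1 : p 1 = 0 := by nlinarith [sq_nonneg m, sq_nonneg (p 0), sq_nonneg (p 1), sq_nonneg (p 2)]
  have e2 : p 2 = 0 := by nlinarith [sq_nonneg m, sq_nonneg (p 0), sq_nonneg (p 1), sq_nonneg (p 2)]
  rw [Set.mem_singleton_iff]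
  funext i
  fin_cases i <;> simp [e0, e1, e2]

lemma norm_le_energy (m : ℝ) (p : Fin 3 → ℝ) : ‖p‖ ≤ energy m p := by
  rw [pi_norm_le_iff_of_nonneg (energy_nonneg m p)]
  intro i
  rw [Real.norm_eq_abs]
  apply Real.abs_le_sqrt
  fin_cases i <;> simp <;> nlinarith [sq_nonneg m, sq_nonneg (p 0), sq_nonneg (p 1), sq_nonneg (p 2)]

lemma integrable_exp_energy {ε : ℝ} (hε : 0 < ε) (m : ℝ) :
    Integrable (fun p : Fin 3 → ℝ => Real.exp (-(ε * energy m p))) := by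
  have h1 : Integrable (fun p : Fin 3 → ℝ => (1 + ‖p‖) ^ (-(4 : ℝ))) :=
    integrable_one_add_norm (by simp; norm_num)
  refine (h1.const_mul (Real.exp ε * 24 / ε ^ 4)).mono' ?_ (Eventually.of_forall fun p => ?_)
  · have := measurable_energy m
    exact (by fun_prop : Measurable _).aestronglyMeasurable
  · rw [Real.norm_eq_abs, abs_of_pos (Real.exp_pos _)]
    have hs : 0 < 1 + ‖p‖ := by positivity
    have h2 := Real.pow_div_factorial_le_exp (ε * (1 + ‖p‖)) (by positivity) 4
    have h3 : Real.exp (ε * (1 + ‖p‖)) ≤ Real.exp ε * Real.exp (ε * energy m p) := by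
      rw [← Real.exp_add]
      apply Real.exp_le_exp.2
      nlinarith [norm_le_energy m p]
    have h4 : (1 + ‖p‖) ^ (-(4 : ℝ)) = ((1 + ‖p‖) ^ 4)⁻¹ := by
      rw [Real.rpow_neg hs.le]; norm_cast
    rw [h4, Real.exp_neg]
    have h5 : (ε * (1 + ‖p‖)) ^ 4 ≤ 24 * (Real.exp ε * Real.exp (ε * energy m p)) := by
      have : ((Nat.factorial 4 : ℕ) : ℝ) = 24 := by norm_num [Nat.factorial]
      rw [this] at h2
      linarith
    have h6 := Real.exp_pos (ε * energy m p)
    rw [← div_eq_mul_inv, div_div, inv_eq_one_div, div_le_div_iff₀ h6 (by positivity)]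
    rw [mul_pow] at h5
    linarith

/-- The density of `shellMeasure` against `stateMeasure`, times the plane wave. -/
def planeWaveDensity (ε : ℝ) (x k : Spacetime) : ℂ :=
  (((2 * Real.pi) ^ 4 * (2 * |k 0|) : ℝ) : ℂ) * planeWave ε x k

lemma norm_planeWave (ε : ℝ) (x k : Spacetime) :
    ‖planeWave ε x k‖ = ((2 * Real.pi) ^ 4)⁻¹ * Real.exp (ε * k 0 / 2) := by
  unfold planeWave
  rw [norm_mul, norm_mul, Complex.norm_exp, Complex.norm_exp]
  have e1 : (-Complex.I * (mink k x : ℂ)).re = 0 := by simp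
  have e2 : ((ε : ℂ) * (k 0 : ℂ) / 2).re = ε * k 0 / 2 := by
    rw [← Complex.ofReal_mul, ← Complex.ofReal_ofNat, ← Complex.ofReal_div, Complex.ofReal_re]
  rw [e1, e2, Real.exp_zero, mul_one]
  congr 1
  rw [norm_inv, norm_pow, norm_mul, Complex.norm_real]
  simp [abs_of_pos Real.pi_pos]

lemma norm_planeWaveDensity (ε : ℝ) (x k : Spacetime) :
    ‖planeWaveDensity ε x k‖ = 2 * |k 0| * Real.exp (ε * k 0 / 2) := by
  unfold planeWaveDensity
  have hp := Real.pi_pos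
  rw [norm_mul, norm_planeWave, Complex.norm_real, Real.norm_eq_abs,
    abs_of_nonneg (by positivity)]
  field_simp

lemma memLp_planeWaveDensity {ε : ℝ} (hε : 0 < ε) (m : ℝ) (x : Spacetime) :
    MemLp (planeWaveDensity ε x) 2 (stateMeasure m) := by
  have hmeas : Measurable (planeWaveDensity ε x) := by
    have := measurable_planeWave ε x
    unfold planeWaveDensity; fun_prop
  rw [memLp_two_iff_integrable_sq_norm hmeas.aestronglyMeasurable]
  simp only [norm_planeWaveDensity]
  unfold stateMeasure
  rw [integrable_withDensity_iff_integrable_smul' (by fun_prop)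
    (Eventually.of_forall fun _ => ENNReal.ofReal_lt_top)]
  unfold shellMeasure
  rw [integrable_map_measure (by fun_prop) (measurable_lowerShell m).aemeasurable,
    integrable_withDensity_iff_integrable_smul'
      (by have := measurable_energy m; fun_prop)
      (Eventually.of_forall fun _ => ENNReal.ofReal_lt_top)]
  refine ((integrable_exp_energy hε m).const_mul (((2 * Real.pi) ^ 4)⁻¹)).congr ?_
  filter_upwards [energy_pos_ae m] with p hp
  have hpi := Real.pi_pos
  have h0 : lowerShell m p 0 = -energy m p := rfl
  simp only [Function.comp, h0, abs_neg, abs_of_pos hp, smul_eq_mul]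
  have h1 : Real.exp (ε * -energy m p / 2) ^ 2 = Real.exp (-(ε * energy m p)) := by
    rw [← Real.exp_nat_mul]; congr 1; push_cast; ring
  rw [ENNReal.toReal_ofReal (by positivity), ENNReal.toReal_ofReal (by positivity),
    mul_pow (2 * energy m p), h1]
  field_simp

lemma k0_ne_zero_ae (m : ℝ) : ∀ᵐ k ∂(shellMeasure m), k 0 ≠ 0 := by
  unfold shellMeasure
  have hs : MeasurableSet {k : Spacetime | k 0 ≠ 0} :=
    (measurableSet_eq_fun (measurable_pi_apply 0) measurable_const).compl
  rw [ae_map_iff (measurable_lowerShell m).aemeasurable hs]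
  refine (withDensity_absolutelyContinuous _ _).ae_le ?_
  filter_upwards [energy_pos_ae m] with p hp
  have h0 : lowerShell m p 0 = -energy m p := rfl
  rw [h0]
  exact (neg_lt_zero.2 hp).ne

lemma waveEvalFun_eq {ε : ℝ} (hε : 0 < ε) (m : ℝ) (x : Spacetime) (u : Sea m) :
    waveEvalFun ε m x u =
      (ContinuousLinearMap.lsmul ℂ ℂ (E := Spinor)).lpPairing (stateMeasure m) 2 2
        ((memLp_planeWaveDensity hε m x).toLp _) (u : Lp Spinor 2 (stateMeasure m)) := by
  rw [ContinuousLinearMap.lpPairing_eq_integral]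
  have h1 : ∫ k, (ContinuousLinearMap.lsmul ℂ ℂ (E := Spinor))
        ((memLp_planeWaveDensity hε m x).toLp _ k)
        ((u : Lp Spinor 2 (stateMeasure m)) k) ∂(stateMeasure m) =
      ∫ k, planeWaveDensity ε x k • (u : Lp Spinor 2 (stateMeasure m)) k
        ∂(stateMeasure m) := by
    apply integral_congr_ae
    filter_upwards [(memLp_planeWaveDensity hε m x).coeFn_toLp] with k hk
    rw [hk, ContinuousLinearMap.lsmul_apply]
  rw [h1]
  conv_rhs => unfold stateMeasure
  rw [integral_withDensity_eq_integral_toReal_smul (by fun_prop)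
    (Eventually.of_forall fun _ => ENNReal.ofReal_lt_top)]
  unfold waveEvalFun
  apply integral_congr_ae
  filter_upwards [k0_ne_zero_ae m] with k hk
  have hpi := Real.pi_pos
  have hk' : 0 < |k 0| := abs_pos.2 hk
  rw [ENNReal.toReal_ofReal (by positivity)]
  unfold planeWaveDensity
  rw [← Complex.coe_smul, smul_smul, ← mul_assoc, ← Complex.ofReal_mul,
    one_div_mul_cancel (by positivity), Complex.ofReal_one, one_mul]
  rfl

/-- The `iε`-regularized wave evaluation operator `Ψ(x)`, as a bounded operator. -/
def waveEval {ε : ℝ} (hε : 0 < ε) (m : ℝ) (x : Spacetime) : Sea m →L[ℂ] Spinor :=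
  LinearMap.mkContinuousOfExistsBound
    { toFun := waveEvalFun ε m x
      map_add' := fun u v => by
        simp only [waveEvalFun_eq hε, Submodule.coe_add, map_add]
      map_smul' := fun c u => by
        simp only [waveEvalFun_eq hε, Submodule.coe_smul, map_smul, RingHom.id_apply] }
    ⟨_, fun u => by
      change ‖waveEvalFun ε m x u‖ ≤ _
      rw [waveEvalFun_eq hε]
      exact ContinuousLinearMap.le_opNorm _ _⟩

lemma waveEval_apply {ε : ℝ} (hε : 0 < ε) (m : ℝ) (x : Spacetime) (u : Sea m) :
    waveEval hε m x u = waveEvalFun ε m x u := rfl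

/-! ### Spin adjoints, kernel of the fermionic projector, Lagrangian -/

section SpinAdjoint

variable {H : Type*} [NormedAddCommGroup H] [InnerProductSpace ℂ H] [CompleteSpace H]

/-- The adjoint `A^* : ℂ⁴ → H` of `A : H → ℂ⁴` with respect to the spin inner product
`φ† γ⁰ χ`, characterized by `⟨A^* φ, u⟩ = φ† γ⁰ (A u)`. -/
def spinAdjoint (A : H →L[ℂ] Spinor) : Spinor →L[ℂ] H :=
  ContinuousLinearMap.adjoint A ∘L Matrix.toEuclideanCLM (n := Fin 4) (𝕜 := ℂ) (gamma 0)

/-- The kernel of the fermionic projector `-A B^*` for wave evaluation operators `A`, `B` at two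
points. -/
def fermionicKernel (A B : H →L[ℂ] Spinor) : Spinor →L[ℂ] Spinor := -(A ∘L spinAdjoint B)

end SpinAdjoint

/-- The spin adjoint `γ⁰ P† γ⁰` of an operator `P : S_y → S_x` between spin spaces. -/
def kernelAdjoint (P : Spinor →L[ℂ] Spinor) : Spinor →L[ℂ] Spinor :=
  Matrix.toEuclideanCLM (n := Fin 4) (𝕜 := ℂ) (gamma 0) ∘L spinAdjoint P

/-- The eigenvalues, with algebraic multiplicity, of the closed chain `P P^*`. -/
def chainEigenvalues (P : Spinor →L[ℂ] Spinor) : Multiset ℂ :=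
  ((P ∘L kernelAdjoint P : Spinor →L[ℂ] Spinor) : Spinor →ₗ[ℂ] Spinor).charpoly.roots

/-- The causal Lagrangian `(1/4n) ∑_{i,j} (|λ_i| - |λ_j|)²` for spin dimension `n = 2`, as a
function of the kernel of the fermionic projector. -/
def lagrangian (P : Spinor →L[ℂ] Spinor) : ℝ :=
  (1 / 8) * ((chainEigenvalues P).map fun a =>
    ((chainEigenvalues P).map fun b => (‖a‖ - ‖b‖) ^ 2).sum).sum

/-- `Q` is the kernel of the first variation of the Lagrangian at `P`:
`δL = 2 Re tr (Q (δP)^*)` for all `δP`. -/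
def IsVariationKernel (P Q : Spinor →L[ℂ] Spinor) : Prop :=
  ∀ δP : Spinor →L[ℂ] Spinor,
    HasDerivAt (fun τ : ℝ => lagrangian (P + (τ : ℂ) • δP))
      (2 * (LinearMap.trace ℂ Spinor
        ((Q ∘L kernelAdjoint δP : Spinor →L[ℂ] Spinor) : Spinor →ₗ[ℂ] Spinor)).re) 0

/-! ### Perturbations and the CFS current -/

/-- A perturbation of the regularized vacuum: a vector field `v` along spacetime
tangential to the set of local correlation operators, together with the
variation `D_v Ψ` of the wave evaluation operator by which it is represented, i.e. `v(y)` is the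
first variation of `-Ψ(y)^* Ψ(y)`. -/
structure Perturbation {ε : ℝ} (hε : 0 < ε) (m : ℝ) where
  /-- the tangent vectors, as operators on the Hilbert space -/
  v : Spacetime → (Sea m →L[ℂ] Sea m)
  /-- the variation of the wave evaluation operator -/
  DΨ : Spacetime → (Sea m →L[ℂ] Spinor)
  v_eq : ∀ y, v y = -(spinAdjoint (DΨ y) ∘L waveEval hε m y)
    - spinAdjoint (waveEval hε m y) ∘L DΨ y

/-- The varied wave evaluation operator `Ψ_τ(y) = Ψ(y) + τ D_v Ψ(y)`. -/
def Perturbation.waveEvalAt {ε : ℝ} {hε : 0 < ε} {m : ℝ} (p : Perturbation hε m) (τ : ℝ)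
    (y : Spacetime) : Sea m →L[ℂ] Spinor :=
  waveEval hε m y + (τ : ℂ) • p.DΨ y

/-- `J` is the CFS current `J_x(v) = ((D_v Q) Ψ)(x) + (Q D_v Ψ)(x) - r D_v Ψ(x)`, where
`(Q φ)(x) = ∫ Q(x,y) φ(y) dρ(y)`, `ρ` is the image of the Lebesgue measure of `ℝ^{1,3}`, and
`Q_τ(x,y)` is the kernel of the first variation of the Lagrangian at the varied
`P_τ(x,y) = -Ψ_τ(x) Ψ_τ(y)^*`. All integrals and derivatives are required to exist. -/
def IsCFSCurrent {ε : ℝ} {hε : 0 < ε} {m : ℝ} (r : ℝ) (p : Perturbation hε m) (x : Spacetime)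
    (J : Sea m →L[ℂ] Spinor) : Prop :=
  ∃ Q : ℝ → Spacetime → (Spinor →L[ℂ] Spinor),
    (∀ᶠ τ in 𝓝 (0 : ℝ), ∀ᵐ y : Spacetime,
      IsVariationKernel (fermionicKernel (p.waveEvalAt τ x) (p.waveEvalAt τ y)) (Q τ y)) ∧
    ∀ u : Sea m,
      (∀ᶠ τ in 𝓝 (0 : ℝ), Integrable (fun y : Spacetime => Q τ y (waveEval hε m y u))) ∧
      Integrable (fun y : Spacetime => Q 0 y (p.DΨ y u)) ∧
      ∃ DQΨ : Spinor,
        HasDerivAt (fun τ : ℝ => ∫ y : Spacetime, Q τ y (waveEval hε m y u)) DQΨ 0 ∧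
        J u = DQΨ + (∫ y : Spacetime, Q 0 y (p.DΨ y u)) - (r : ℂ) • p.DΨ x u

/-- The iterated partial derivative `∂_{μ₁} ⋯ ∂_{μₙ} Ψ(x)^*`. -/
def partialDerivsAdjoint {ε : ℝ} (hε : 0 < ε) (m : ℝ) (x : Spacetime) {n : ℕ}
    (μ : Fin n → Fin 4) : Spinor →L[ℂ] Sea m :=
  iteratedFDeriv ℝ n (fun y : Spacetime => spinAdjoint (waveEval hε m y)) x
    (fun i => Pi.single (μ i) 1)

end MinkowskiCFS
end

open MinkowskiCFS

/-!
The regularized wave evaluation operator is `Ψ(y) u = ∫ g_y u dμ`, where `μ` is the measure of the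
scalar product and `g_y(k) = 2 |k⁰| e^{ε k⁰ / 2} e^{-iky}` is the plane wave density. It
depends on `y` through the element `g_y` of `L²(μ)` only.

*Smoothness.* On the lower mass shell `‖k‖ ≤ -k⁰`, so the regularizing factor makes all the functions
`‖k‖ⁿ g_y` square integrable. Hence `y ↦ g_y` is smooth with values in `L²(μ)`, each derivative in a
direction `h` producing a factor `-i k_μ h^μ` (`contDiff_phaseLp`, `iteratedFDeriv_phaseLp`), and
`Ψ(y)^*` is the image of `g_y` under a bounded real linear map.

*Density.* A bounded operator `J` which annihilates all `∂_{μ₁} ⋯ ∂_{μₙ} Ψ(x)^*` vanishes because the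
ranges of these operators span a dense subspace (`eq_zero_of_orthogonal`). Indeed, if `u` is
orthogonal to them, then every component of `f = g_x u` satisfies `∫ L(k)ⁿ f dμ = 0` for all real
linear forms `L` and all `n`. Moreover `e^{ε ‖k‖ / 4} f` is integrable. Such a density is determined
by its moments, so `f = 0` (`ae_eq_zero_of_moments`): its Fourier transform extends analytically to
a strip along every line through the origin, and the moments are its Taylor coefficients at `0`.
Since `g_x` has no zeros almost everywhere, `u = 0`. The argument applies to every bounded operator,
in particular to the CFS current.
-/

noncomputable section

namespace MinkowskiCFS

/-! ### Densities determined by their moments -/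

open ProbabilityTheory in
/-- A real random variable with exponential moments of both signs is determined in law by its
moments: the complex moment generating functions are analytic on a strip around the imaginary
axis, and the moments are their Taylor coefficients at `0`. -/
theorem map_eq_of_moments {Ω : Type*} {mΩ : MeasurableSpace Ω} {μ ν : Measure Ω}
    [IsFiniteMeasure μ] [IsFiniteMeasure ν] {X : Ω → ℝ} (hX : Measurable X)
    (hμ : 0 ∈ interior (integrableExpSet X μ)) (hν : 0 ∈ interior (integrableExpSet X ν))
    (h : ∀ n : ℕ, ∫ a, X a ^ n ∂μ = ∫ a, X a ^ n ∂ν) : μ.map X = ν.map X := by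
  set S : Set ℝ := interior (integrableExpSet X μ) ∩ interior (integrableExpSet X ν)
  have hSc : Convex ℝ S := convex_integrableExpSet.interior.inter convex_integrableExpSet.interior
  have hA : AnalyticOnNhd ℂ (complexMGF X μ) {z | z.re ∈ S} :=
    fun z hz => analyticAt_complexMGF hz.1
  have hB : AnalyticOnNhd ℂ (complexMGF X ν) {z | z.re ∈ S} :=
    fun z hz => analyticAt_complexMGF hz.2
  have h0 : (0 : ℂ) ∈ {z : ℂ | z.re ∈ S} := by simpa using ⟨hμ, hν⟩
  have hser : complexMGF X μ =ᶠ[𝓝 0] complexMGF X ν := by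
    have h1 := (hA 0 h0).hasFPowerSeriesAt
    have h2 := (hB 0 h0).hasFPowerSeriesAt
    have h3 : ∀ n : ℕ, iteratedDeriv n (complexMGF X μ) 0 = iteratedDeriv n (complexMGF X ν) 0 := by
      intro n
      rw [iteratedDeriv_complexMGF (by simpa using hμ), iteratedDeriv_complexMGF (by simpa using hν)]
      simp only [zero_mul, Complex.exp_zero, mul_one]
      have := h n
      rw [← Complex.ofReal_inj, ← integral_complex_ofReal, ← integral_complex_ofReal] at this
      simpa using this
    simp only [h3] at h1
    obtain ⟨r, hr⟩ := h1
    obtain ⟨r', hr'⟩ := h2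
    have hpos : 0 < min r r' := lt_min hr.r_pos hr'.r_pos
    filter_upwards [Metric.eball_mem_nhds (0 : ℂ) hpos] with z hz
    exact (hr.mono hpos (min_le_left _ _)).unique (hr'.mono hpos (min_le_right _ _)) hz
  have hEq : Set.EqOn (complexMGF X μ) (complexMGF X ν) {z | z.re ∈ S} :=
    hA.eqOn_of_preconnected_of_eventuallyEq hB
      (hSc.linear_preimage Complex.reLm).isPreconnected h0 hser
  have hI : ∀ t : ℝ, complexMGF X μ (t * Complex.I) = complexMGF X ν (t * Complex.I) :=
    fun t => hEq (by simpa using ⟨hμ, hν⟩)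
  apply Measure.ext_of_charFun
  funext t
  rw [← complexMGF_mul_I hX.aemeasurable, ← complexMGF_mul_I hX.aemeasurable, hI]

/-- Two measures with exponentially decaying tails whose one-dimensional projections have the same
moments agree, since the laws of all projections determine the characteristic function. -/
theorem ext_of_moments {E : Type*} [NormedAddCommGroup E] [NormedSpace ℝ E]
    [MeasurableSpace E] [BorelSpace E] [CompleteSpace E] [SecondCountableTopology E]
    {μ ν : Measure E} {δ : ℝ} (hδ : 0 < δ)
    (hμ : Integrable (fun x => Real.exp (δ * ‖x‖)) μ)
    (hν : Integrable (fun x => Real.exp (δ * ‖x‖)) ν)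
    (h : ∀ (L : StrongDual ℝ E) (n : ℕ), ∫ x, L x ^ n ∂μ = ∫ x, L x ^ n ∂ν) : μ = ν := by
  have hfin : ∀ ρ : Measure E, Integrable (fun x => Real.exp (δ * ‖x‖)) ρ → IsFiniteMeasure ρ := by
    intro ρ hρ
    have h1 : Integrable (fun _ : E => (1 : ℝ)) ρ := by
      refine hρ.mono' (by fun_prop) (Eventually.of_forall fun x => ?_)
      rw [norm_one]
      exact Real.one_le_exp (by positivity)
    simpa [integrable_const_iff] using h1
  have hexp : ∀ ρ : Measure E, Integrable (fun x => Real.exp (δ * ‖x‖)) ρ →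
      ∀ L : StrongDual ℝ E, 0 ∈ interior (ProbabilityTheory.integrableExpSet L ρ) := by
    intro ρ hρ L
    rw [mem_interior_iff_mem_nhds]
    have h1 : Tendsto (fun t : ℝ => |t| * ‖L‖) (𝓝 0) (𝓝 0) := by
      have : Continuous fun t : ℝ => |t| * ‖L‖ := by fun_prop
      simpa using this.tendsto 0
    filter_upwards [h1.eventually (ge_mem_nhds hδ)] with t ht
    refine hρ.mono' (by fun_prop) (Eventually.of_forall fun x => ?_)
    rw [Real.norm_eq_abs, Real.abs_exp, Real.exp_le_exp]
    calc t * L x ≤ |t| * ‖L x‖ := by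
          rw [Real.norm_eq_abs, ← abs_mul]; exact le_abs_self _
      _ ≤ |t| * (‖L‖ * ‖x‖) := by gcongr; exact L.le_opNorm x
      _ = |t| * ‖L‖ * ‖x‖ := by ring
      _ ≤ δ * ‖x‖ := by gcongr
  have := hfin μ hμ
  have := hfin ν hν
  apply Measure.ext_of_charFunDual
  funext L
  rw [charFunDual_eq_charFun_map_one, charFunDual_eq_charFun_map_one,
    map_eq_of_moments (X := L) (by fun_prop) (hexp μ hμ L) (hexp ν hν L) (h L)]

lemma pow_le_mul_exp {δ s : ℝ} (hδ : 0 < δ) (hs : 0 ≤ s) (n : ℕ) :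
    s ^ n ≤ n.factorial / δ ^ n * Real.exp (δ * s) := by
  have h1 := Real.pow_div_factorial_le_exp (δ * s) (by positivity) n
  rw [mul_pow, div_le_iff₀ (by positivity)] at h1
  rw [div_mul_eq_mul_div, le_div_iff₀ (by positivity)]
  linarith

lemma norm_pow_le_mul_exp {E : Type*} [NormedAddCommGroup E] [NormedSpace ℝ E]
    {δ : ℝ} (hδ : 0 < δ) (L : StrongDual ℝ E) (n : ℕ) (x : E) :
    ‖L x ^ n‖ ≤ ‖L‖ ^ n * (n.factorial / δ ^ n) * Real.exp (δ * ‖x‖) := by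
  calc ‖L x ^ n‖ ≤ (‖L‖ * ‖x‖) ^ n := by
        rw [norm_pow]; gcongr; exact L.le_opNorm x
    _ = ‖L‖ ^ n * ‖x‖ ^ n := mul_pow _ _ _
    _ ≤ ‖L‖ ^ n * (n.factorial / δ ^ n * Real.exp (δ * ‖x‖)) := by
        gcongr; exact pow_le_mul_exp hδ (norm_nonneg x) n
    _ = _ := by ring

/-- An exponentially decaying real density all of whose moments vanish is zero: its positive and its
negative part define measures with the same moments. -/
theorem ae_eq_zero_of_moments_real {E : Type*} [NormedAddCommGroup E] [NormedSpace ℝ E]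
    [MeasurableSpace E] [BorelSpace E] [CompleteSpace E] [SecondCountableTopology E]
    {σ : Measure E} {f : E → ℝ} {δ : ℝ} (hδ : 0 < δ)
    (hf : Integrable (fun x => Real.exp (δ * ‖x‖) * f x) σ)
    (h : ∀ (L : StrongDual ℝ E) (n : ℕ), ∫ x, L x ^ n * f x ∂σ = 0) : f =ᵐ[σ] 0 := by
  have hfm : AEStronglyMeasurable f σ := by
    have h1 : AEStronglyMeasurable (fun x => Real.exp (-(δ * ‖x‖))) σ := by fun_prop
    refine (h1.mul hf.aestronglyMeasurable).congr (Eventually.of_forall fun x => ?_)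
    simp only [Pi.mul_apply]
    rw [← mul_assoc, ← Real.exp_add, neg_add_cancel, Real.exp_zero, one_mul]
  -- Used with `g` the positive or negative part of `f` and `w` a power of a linear form or the
  -- exponential weight itself.
  have key : ∀ (g w : E → ℝ) (C : ℝ), AEStronglyMeasurable g σ → Continuous w →
      (∀ x, ‖g x‖ ≤ ‖f x‖) → (∀ x, ‖w x‖ ≤ C * Real.exp (δ * ‖x‖)) →
      Integrable (fun x => g x * w x) σ := by
    intro g w C hg hw hgf hwC
    refine (hf.norm.const_mul C).mono' (hg.mul hw.aestronglyMeasurable)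
      (Eventually.of_forall fun x => ?_)
    rw [norm_mul, norm_mul, Real.norm_of_nonneg (Real.exp_pos _).le]
    calc ‖g x‖ * ‖w x‖ ≤ ‖f x‖ * (C * Real.exp (δ * ‖x‖)) :=
          mul_le_mul (hgf x) (hwC x) (norm_nonneg _) (norm_nonneg _)
      _ = _ := by ring
  have hpm : AEMeasurable (fun x => ENNReal.ofReal (f x)) σ := hfm.aemeasurable.ennreal_ofReal
  have hnm : AEMeasurable (fun x => ENNReal.ofReal (-f x)) σ :=
    hfm.aemeasurable.neg.ennreal_ofReal
  have hpb : ∀ x, ‖max (f x) 0‖ ≤ ‖f x‖ := fun x => by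
    rw [Real.norm_of_nonneg (le_max_right _ _)]
    exact max_le (Real.le_norm_self _) (norm_nonneg _)
  have hnb : ∀ x, ‖max (-f x) 0‖ ≤ ‖f x‖ := fun x => by
    rw [Real.norm_of_nonneg (le_max_right _ _), ← norm_neg (f x)]
    exact max_le (Real.le_norm_self _) (norm_nonneg _)
  have hp : AEStronglyMeasurable (fun x => max (f x) 0) σ := hfm.sup aestronglyMeasurable_const
  have hn : AEStronglyMeasurable (fun x => max (-f x) 0) σ :=
    hfm.neg.sup aestronglyMeasurable_const
  have hexp1 : ∀ x : E, ‖Real.exp (δ * ‖x‖)‖ ≤ 1 * Real.exp (δ * ‖x‖) := fun x => by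
    rw [one_mul, Real.norm_of_nonneg (Real.exp_pos _).le]
  have hμν : σ.withDensity (fun x => ENNReal.ofReal (f x)) =
      σ.withDensity (fun x => ENNReal.ofReal (-f x)) := by
    refine ext_of_moments hδ ?_ ?_ fun L n => ?_
    · rw [integrable_withDensity_iff_integrable_smul₀' hpm (by simp)]
      simpa [ENNReal.toReal_ofReal'] using key _ _ 1 hp (by fun_prop) hpb hexp1
    · rw [integrable_withDensity_iff_integrable_smul₀' hnm (by simp)]
      simpa [ENNReal.toReal_ofReal'] using key _ _ 1 hn (by fun_prop) hnb hexp1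
    · rw [integral_withDensity_eq_integral_toReal_smul₀ hpm (by simp),
        integral_withDensity_eq_integral_toReal_smul₀ hnm (by simp), ← sub_eq_zero]
      simp only [ENNReal.toReal_ofReal', smul_eq_mul]
      rw [← integral_sub (key _ _ _ hp (by fun_prop) hpb (norm_pow_le_mul_exp hδ L n))
        (key _ _ _ hn (by fun_prop) hnb (norm_pow_le_mul_exp hδ L n))]
      refine (integral_congr_ae (Eventually.of_forall fun x => ?_)).trans (h L n)
      rw [← sub_mul, mul_comm]
      congr 1
      rcases le_total 0 (f x) with h0 | h0
      · rw [max_eq_left h0, max_eq_right (by linarith), sub_zero]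
      · rw [max_eq_right h0, max_eq_left (by linarith)]; ring
  have hfin : ∫⁻ x, ENNReal.ofReal (f x) ∂σ ≠ ⊤ := by
    have h1 := key _ _ 1 hfm (continuous_const (y := (1 : ℝ))) (fun x => le_rfl) fun x => by
      rw [norm_one, one_mul]; exact Real.one_le_exp (by positivity)
    simp only [mul_one] at h1
    exact (h1.lintegral_lt_top).ne
  filter_upwards [(withDensity_eq_iff hpm hnm hfin).1 hμν] with x hx
  rcases le_total 0 (f x) with h0 | h0
  · rw [ENNReal.ofReal_of_nonpos (p := -f x) (by linarith), ENNReal.ofReal_eq_zero] at hx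
    exact le_antisymm hx h0
  · rw [ENNReal.ofReal_of_nonpos h0, eq_comm, ENNReal.ofReal_eq_zero] at hx
    exact le_antisymm h0 (neg_nonpos.1 hx)

/-- The moment theorem for complex densities. The linear forms `L` are real, so the moments of the
real and of the imaginary part of `f` vanish separately. -/
theorem ae_eq_zero_of_moments {E : Type*} [NormedAddCommGroup E] [NormedSpace ℝ E]
    [MeasurableSpace E] [BorelSpace E] [CompleteSpace E] [SecondCountableTopology E]
    {σ : Measure E} {f : E → ℂ} {δ : ℝ} (hδ : 0 < δ)
    (hf : Integrable (fun x => (Real.exp (δ * ‖x‖) : ℂ) * f x) σ)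
    (h : ∀ (L : StrongDual ℝ E) (n : ℕ), ∫ x, (L x : ℂ) ^ n * f x ∂σ = 0) : f =ᵐ[σ] 0 := by
  have hfm : AEStronglyMeasurable f σ := by
    have h1 : AEStronglyMeasurable (fun x => (Real.exp (-(δ * ‖x‖)) : ℂ)) σ := by fun_prop
    refine (h1.mul hf.aestronglyMeasurable).congr (Eventually.of_forall fun x => ?_)
    simp only [Pi.mul_apply]
    rw [← mul_assoc, ← Complex.ofReal_mul, ← Real.exp_add, neg_add_cancel, Real.exp_zero,
      Complex.ofReal_one, one_mul]
  have hint : ∀ (L : StrongDual ℝ E) (n : ℕ), Integrable (fun x => (L x : ℂ) ^ n * f x) σ := by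
    intro L n
    refine (hf.norm.const_mul (‖L‖ ^ n * (n.factorial / δ ^ n))).mono' (by fun_prop)
      (Eventually.of_forall fun x => ?_)
    rw [norm_mul, norm_mul, Complex.norm_real, Real.norm_of_nonneg (Real.exp_pos _).le,
      ← mul_assoc, ← Complex.ofReal_pow, Complex.norm_real]
    gcongr
    exact norm_pow_le_mul_exp hδ L n x
  have hre : (fun x => (f x).re) =ᵐ[σ] 0 := by
    refine ae_eq_zero_of_moments_real hδ ?_ fun L n => ?_
    · simpa [-Complex.ofReal_exp, Complex.re_ofReal_mul] using hf.re
    · have h1 := congrArg Complex.re (h L n)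
      rw [← RCLike.re_eq_complex_re, ← integral_re (hint L n)] at h1
      simpa [← Complex.ofReal_pow] using h1
  have him : (fun x => (f x).im) =ᵐ[σ] 0 := by
    refine ae_eq_zero_of_moments_real hδ ?_ fun L n => ?_
    · simpa [-Complex.ofReal_exp, Complex.im_ofReal_mul] using hf.im
    · have h1 := congrArg Complex.im (h L n)
      rw [← RCLike.im_eq_complex_im, ← integral_im (hint L n)] at h1
      simpa [← Complex.ofReal_pow] using h1
  filter_upwards [hre, him] with x h1 h2
  exact Complex.ext h1 h2

/-! ### Smooth families of phases in `L²` -/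

lemma norm_exp_neg_I_mul_sub_le (t : ℝ) :
    ‖Complex.exp (-Complex.I * t) - 1 - -Complex.I * t‖ ≤ 3 * |t| ^ 2 := by
  have hn : ‖-Complex.I * (t : ℂ)‖ = |t| := by simp
  rcases le_total |t| 1 with h | h
  · have h1 := Complex.norm_exp_sub_one_sub_id_le (x := -Complex.I * t) (by rw [hn]; exact h)
    rw [hn] at h1
    nlinarith [sq_nonneg |t|]
  · have h1 : ‖Complex.exp (-Complex.I * t)‖ = 1 := by rw [Complex.norm_exp]; simp
    have h2 := norm_sub_le (Complex.exp (-Complex.I * t) - 1) (-Complex.I * t)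
    have h3 := norm_sub_le (Complex.exp (-Complex.I * t)) 1
    rw [hn] at h2
    rw [h1, norm_one] at h3
    nlinarith

section PhaseFamily

variable {Ω ι : Type*} [MeasurableSpace Ω] [Fintype ι]

lemma abs_dotProduct_le (v h : ι → ℝ) : |v ⬝ᵥ h| ≤ Fintype.card ι * ‖v‖ * ‖h‖ := by
  calc |v ⬝ᵥ h| ≤ ∑ i, |v i * h i| := Finset.abs_sum_le_sum_abs _ _
    _ ≤ ∑ _i : ι, ‖v‖ * ‖h‖ := by
        refine Finset.sum_le_sum fun i _ => ?_
        rw [abs_mul]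
        exact mul_le_mul (norm_le_pi_norm v i) (norm_le_pi_norm h i) (abs_nonneg _) (norm_nonneg _)
    _ = _ := by simp [mul_assoc]

/-- `a` is square integrable with all its moments: `‖θ‖ⁿ a ∈ L²(μ)` for every `n`. For such an
amplitude, `y ↦ e^{-i θ · y} a` can be differentiated in `L²(μ)` arbitrarily often. -/
def HasMoments (μ : Measure Ω) (θ : Ω → ι → ℝ) (a : Ω → ℂ) : Prop :=
  ∀ n : ℕ, MemLp (fun w => (‖θ w‖ : ℂ) ^ n * a w) 2 μ

variable {μ : Measure Ω} {θ : Ω → ι → ℝ} {a : Ω → ℂ}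

lemma HasMoments.memLp (ha : HasMoments μ θ a) : MemLp a 2 μ := by simpa using ha 0

lemma measurable_dotProduct_left (hθ : Measurable θ) (h : ι → ℝ) :
    Measurable fun w => θ w ⬝ᵥ h := by
  unfold dotProduct; fun_prop

lemma HasMoments.mul_dotProduct (hθ : Measurable θ) (ha : HasMoments μ θ a) (h : ι → ℝ) :
    HasMoments μ θ fun w => -Complex.I * (θ w ⬝ᵥ h : ℝ) * a w := by
  intro n
  have hm := measurable_dotProduct_left hθ h
  have ham := ha.memLp.aestronglyMeasurable
  refine (ha (n + 1)).of_le_mul (c := Fintype.card ι * ‖h‖) (by fun_prop)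
    (Eventually.of_forall fun w => ?_)
  simp only [norm_mul, norm_pow, Complex.norm_real, norm_neg, Complex.norm_I, one_mul, norm_norm,
    Real.norm_eq_abs (θ w ⬝ᵥ h)]
  calc ‖θ w‖ ^ n * (|θ w ⬝ᵥ h| * ‖a w‖)
      ≤ ‖θ w‖ ^ n * (Fintype.card ι * ‖θ w‖ * ‖h‖ * ‖a w‖) := by
        gcongr; exact abs_dotProduct_le _ _
    _ = _ := by ring

lemma HasMoments.mul_prod (hθ : Measurable θ) (ha : HasMoments μ θ a) {n : ℕ}
    (h : Fin n → ι → ℝ) :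
    HasMoments μ θ fun w => (∏ i, -Complex.I * (θ w ⬝ᵥ h i : ℝ)) * a w := by
  induction n with
  | zero => simpa using ha
  | succ n ih =>
    have h1 := (ih (Fin.tail h)).mul_dotProduct hθ (h 0)
    simpa only [Fin.prod_univ_succ, Fin.tail, mul_assoc] using h1

lemma HasMoments.memLp_phase (hθ : Measurable θ) (ha : HasMoments μ θ a) (y : ι → ℝ) :
    MemLp (fun w => Complex.exp (-Complex.I * (θ w ⬝ᵥ y : ℝ)) * a w) 2 μ := by
  have hm := measurable_dotProduct_left hθ y
  have ham := ha.memLp.aestronglyMeasurable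
  refine ha.memLp.of_le (by fun_prop) (Eventually.of_forall fun w => ?_)
  rw [norm_mul, Complex.norm_exp]
  simp

/-- The element `e^{-i θ · y} a` of `L²(μ)`, as a function of `y`. -/
def phaseLp (hθ : Measurable θ) (ha : HasMoments μ θ a) (y : ι → ℝ) : Lp ℂ 2 μ :=
  (ha.memLp_phase hθ y).toLp _

lemma coeFn_phaseLp (hθ : Measurable θ) (ha : HasMoments μ θ a) (y : ι → ℝ) :
    phaseLp hθ ha y =ᵐ[μ] fun w => Complex.exp (-Complex.I * (θ w ⬝ᵥ y : ℝ)) * a w :=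
  (ha.memLp_phase hθ y).coeFn_toLp

variable [DecidableEq ι]

/-- The derivative of `phaseLp`, written as a sum over coordinates: each summand is a constant linear
map times `phaseLp` for the amplitude `-i θⱼ a`, which again has all moments. -/
def phaseLpDeriv (hθ : Measurable θ) (ha : HasMoments μ θ a) (y : ι → ℝ) :
    (ι → ℝ) →L[ℝ] Lp ℂ 2 μ :=
  ∑ j, (ContinuousLinearMap.proj j : (ι → ℝ) →L[ℝ] ℝ).smulRight
    (phaseLp hθ (ha.mul_dotProduct hθ (Pi.single j 1)) y)

lemma phaseLpDeriv_apply (hθ : Measurable θ) (ha : HasMoments μ θ a) (y h : ι → ℝ) :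
    phaseLpDeriv hθ ha y h = phaseLp hθ (ha.mul_dotProduct hθ h) y := by
  simp only [phaseLpDeriv, sum_apply, ContinuousLinearMap.smulRight_apply,
    ContinuousLinearMap.proj_apply]
  apply Lp.ext
  -- Pointwise representatives of the summands, outside of one null set common to all `j`.
  have h1 : ∀ᵐ w ∂μ, ∀ j, (h j • phaseLp hθ (ha.mul_dotProduct hθ (Pi.single j 1)) y : Lp ℂ 2 μ) w
      = h j • (Complex.exp (-Complex.I * (θ w ⬝ᵥ y : ℝ)) *
        (-Complex.I * (θ w ⬝ᵥ Pi.single j 1 : ℝ) * a w)) := by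
    rw [ae_all_iff]
    intro j
    filter_upwards [Lp.coeFn_smul (h j) (phaseLp hθ (ha.mul_dotProduct hθ (Pi.single j 1)) y),
      coeFn_phaseLp hθ (ha.mul_dotProduct hθ (Pi.single j 1)) y] with w h2 h3
    rw [h2, Pi.smul_apply, h3]
  filter_upwards [Lp.coeFn_finsetSum Finset.univ fun j =>
    (h j • phaseLp hθ (ha.mul_dotProduct hθ (Pi.single j 1)) y : Lp ℂ 2 μ), h1,
    coeFn_phaseLp hθ (ha.mul_dotProduct hθ h) y] with w h2 h3 h4
  rw [h2, h4, Finset.sum_apply, Finset.sum_congr rfl fun j _ => h3 j]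
  simp only [dotProduct_single, mul_one, Complex.real_smul]
  have e : θ w ⬝ᵥ h = ∑ j, θ w j * h j := rfl
  rw [e, Complex.ofReal_sum, Finset.mul_sum, Finset.sum_mul, Finset.mul_sum]
  refine Finset.sum_congr rfl fun j _ => ?_
  push_cast
  ring

lemma hasFDerivAt_phaseLp (hθ : Measurable θ) (ha : HasMoments μ θ a) (y : ι → ℝ) :
    HasFDerivAt (phaseLp hθ ha) (phaseLpDeriv hθ ha y) y := by
  rw [hasFDerivAt_iff_isLittleO_nhds_zero]
  refine Asymptotics.IsBigO.trans_isLittleO (g := fun h : ι → ℝ => ‖h‖ ^ 2) ?_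
    (Asymptotics.isLittleO_norm_pow_id one_lt_two)
  refine Asymptotics.IsBigO.of_bound (3 * (Fintype.card ι : ℝ) ^ 2 * ‖(ha 2).toLp _‖)
    (Eventually.of_forall fun h => ?_)
  rw [phaseLpDeriv_apply, Real.norm_of_nonneg (by positivity : 0 ≤ ‖h‖ ^ 2)]
  -- The pointwise remainder is `O(|θ · h|²)`, so the second moment of `a` bounds it in `L²`.
  have key : ‖phaseLp hθ ha (y + h) - phaseLp hθ ha y - phaseLp hθ (ha.mul_dotProduct hθ h) y‖ ≤
      (3 * (Fintype.card ι : ℝ) ^ 2 * ‖h‖ ^ 2) * ‖(ha 2).toLp _‖ := by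
    apply Lp.norm_le_mul_norm_of_ae_le_mul
    filter_upwards [Lp.coeFn_sub (phaseLp hθ ha (y + h) - phaseLp hθ ha y)
      (phaseLp hθ (ha.mul_dotProduct hθ h) y),
      Lp.coeFn_sub (phaseLp hθ ha (y + h)) (phaseLp hθ ha y), coeFn_phaseLp hθ ha (y + h),
      coeFn_phaseLp hθ ha y, coeFn_phaseLp hθ (ha.mul_dotProduct hθ h) y, (ha 2).coeFn_toLp]
      with w h1 h2 h3 h4 h5 h6
    rw [h1, Pi.sub_apply, h2, Pi.sub_apply, h3, h4, h5, h6]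
    have e : Complex.exp (-Complex.I * (θ w ⬝ᵥ (y + h) : ℝ)) * a w
        - Complex.exp (-Complex.I * (θ w ⬝ᵥ y : ℝ)) * a w
        - Complex.exp (-Complex.I * (θ w ⬝ᵥ y : ℝ)) * (-Complex.I * (θ w ⬝ᵥ h : ℝ) * a w)
        = Complex.exp (-Complex.I * (θ w ⬝ᵥ y : ℝ)) *
          (Complex.exp (-Complex.I * (θ w ⬝ᵥ h : ℝ)) - 1 - -Complex.I * (θ w ⬝ᵥ h : ℝ)) * a w := by
      rw [dotProduct_add, Complex.ofReal_add, mul_add, Complex.exp_add]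
      ring
    rw [e, norm_mul, norm_mul, norm_mul, norm_pow, Complex.norm_real, norm_norm, Complex.norm_exp]
    have e2 : (-Complex.I * ((θ w ⬝ᵥ y : ℝ) : ℂ)).re = 0 := by simp
    rw [e2, Real.exp_zero, one_mul, ← mul_assoc]
    gcongr
    calc _ ≤ 3 * |θ w ⬝ᵥ h| ^ 2 := norm_exp_neg_I_mul_sub_le _
      _ ≤ 3 * (Fintype.card ι * ‖θ w‖ * ‖h‖) ^ 2 := by gcongr; exact abs_dotProduct_le _ _
      _ = _ := by ring
  linarith

/-- Smoothness follows by induction over the order, for all amplitudes at once, because the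
derivative is again made of functions of the form `phaseLp`. -/
lemma contDiff_phaseLp (hθ : Measurable θ) (ha : HasMoments μ θ a) :
    ContDiff ℝ ∞ (phaseLp hθ ha) := by
  rw [contDiff_infty]
  intro n
  induction n generalizing a with
  | zero =>
    exact contDiff_zero.2 (continuous_iff_continuousAt.2
      fun y => (hasFDerivAt_phaseLp hθ ha y).continuousAt)
  | succ n ih =>
    refine contDiff_succ_iff_hasFDerivAt.2 ⟨phaseLpDeriv hθ ha, ?_, hasFDerivAt_phaseLp hθ ha⟩
    unfold phaseLpDeriv
    exact ContDiff.sum fun j _ => contDiff_const.smulRight (ih _)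

lemma iteratedFDeriv_phaseLp (hθ : Measurable θ) (ha : HasMoments μ θ a) {n : ℕ}
    (y : ι → ℝ) (h : Fin n → ι → ℝ) :
    iteratedFDeriv ℝ n (phaseLp hθ ha) y h = phaseLp hθ (ha.mul_prod hθ h) y := by
  induction n generalizing y with
  | zero => simp [iteratedFDeriv_zero_apply]
  | succ n ih =>
    have hd : DifferentiableAt ℝ (iteratedFDeriv ℝ n (phaseLp hθ ha)) y :=
      ((contDiff_phaseLp hθ ha).differentiable_iteratedFDeriv
        (by exact_mod_cast ENat.natCast_lt_top n)) y
    rw [hd.iteratedFDeriv_succ_apply_left']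
    simp only [ih]
    rw [(hasFDerivAt_phaseLp hθ (ha.mul_prod hθ (Fin.tail h)) y).fderiv, phaseLpDeriv_apply]
    congr 1
    funext w
    rw [Fin.prod_univ_succ, mul_assoc (-Complex.I * _)]
    rfl

end PhaseFamily

/-! ### The wave evaluation operator and its adjoint -/

/-- The covector `k_μ` of a momentum `k`, so that the Minkowski product is the coordinate pairing
`lowerIndex k ⬝ᵥ x`. -/
def lowerIndex (k : Spacetime) : Spacetime := ![k 0, -k 1, -k 2, -k 3]

lemma measurable_lowerIndex : Measurable lowerIndex := by
  rw [measurable_pi_iff]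
  intro i
  fin_cases i <;> simp [lowerIndex] <;> fun_prop

lemma lowerIndex_dotProduct (k x : Spacetime) : lowerIndex k ⬝ᵥ x = mink k x := by
  simp [lowerIndex, mink, dotProduct, Fin.sum_univ_four]
  ring

lemma norm_lowerIndex (k : Spacetime) : ‖lowerIndex k‖ = ‖k‖ := by
  have h : ∀ i, ‖lowerIndex k i‖ = ‖k i‖ := by
    intro i
    fin_cases i <;> simp [lowerIndex]
  simp only [Pi.norm_def, nnnorm, h]

lemma planeWaveDensity_eq (ε : ℝ) (x k : Spacetime) :
    planeWaveDensity ε x k =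
      Complex.exp (-Complex.I * (lowerIndex k ⬝ᵥ x : ℝ)) * planeWaveDensity ε 0 k := by
  rw [lowerIndex_dotProduct]
  simp [planeWaveDensity, planeWave, mink]
  ring

lemma norm_le_neg_ae (m : ℝ) : ∀ᵐ k ∂(stateMeasure m), ‖k‖ ≤ -k 0 := by
  refine (withDensity_absolutelyContinuous _ _).ae_le ?_
  unfold shellMeasure
  have hs : MeasurableSet {k : Spacetime | ‖k‖ ≤ -k 0} :=
    measurableSet_le measurable_norm (measurable_pi_apply 0).neg
  refine (ae_map_iff (measurable_lowerShell m).aemeasurable hs).2 ?_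
  refine Eventually.of_forall fun p => ?_
  have h0 : lowerShell m p 0 = -energy m p := rfl
  rw [h0, neg_neg, pi_norm_le_iff_of_nonneg (energy_nonneg m p)]
  have hp : ∀ i, ‖p i‖ ≤ energy m p := fun i => (norm_le_pi_norm p i).trans (norm_le_energy m p)
  intro i
  fin_cases i
  · simp [lowerShell, abs_of_nonneg (energy_nonneg m p)]
  · exact hp 0
  · exact hp 1
  · exact hp 2

/-- On the lower mass shell half of the regularizing factor `e^{ε k⁰ / 2}` can be traded for the
exponential weight `e^{ε ‖k‖ / 4}`. -/
lemma exp_mul_norm_planeWaveDensity_le {ε : ℝ} (hε : 0 < ε) (x : Spacetime) {k : Spacetime}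
    (hk : ‖k‖ ≤ -k 0) :
    Real.exp (ε / 4 * ‖k‖) * ‖planeWaveDensity ε x k‖ ≤ ‖planeWaveDensity (ε / 2) x k‖ := by
  rw [norm_planeWaveDensity, norm_planeWaveDensity, mul_left_comm, ← Real.exp_add]
  gcongr
  nlinarith

lemma measurable_planeWaveDensity (ε : ℝ) (x : Spacetime) : Measurable (planeWaveDensity ε x) := by
  have := measurable_planeWave ε x
  unfold planeWaveDensity; fun_prop

lemma hasMoments_planeWaveDensity {ε : ℝ} (hε : 0 < ε) (m : ℝ) (x : Spacetime) :
    HasMoments (stateMeasure m) lowerIndex (planeWaveDensity ε x) := by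
  intro n
  have h1 := measurable_planeWaveDensity ε x
  have h2 := measurable_lowerIndex
  refine (memLp_planeWaveDensity (half_pos hε) m x).of_le_mul
    (c := n.factorial / (ε / 4) ^ n) (by fun_prop) ?_
  filter_upwards [norm_le_neg_ae m] with k hk
  have h3 := exp_mul_norm_planeWaveDensity_le hε x hk
  have h4 := pow_le_mul_exp (by positivity : 0 < ε / 4) (norm_nonneg k) n
  rw [norm_mul, norm_pow, Complex.norm_real, norm_norm, norm_lowerIndex]
  calc ‖k‖ ^ n * ‖planeWaveDensity ε x k‖
      ≤ n.factorial / (ε / 4) ^ n * Real.exp (ε / 4 * ‖k‖) * ‖planeWaveDensity ε x k‖ := by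
        gcongr
    _ = n.factorial / (ε / 4) ^ n * (Real.exp (ε / 4 * ‖k‖) * ‖planeWaveDensity ε x k‖) := by ring
    _ ≤ _ := by gcongr

/-- The plane wave density at the point `y`, as an element of `L²`. -/
def planeWaveLp {ε : ℝ} (hε : 0 < ε) (m : ℝ) : Spacetime → Lp ℂ 2 (stateMeasure m) :=
  phaseLp measurable_lowerIndex (hasMoments_planeWaveDensity hε m 0)

lemma lpPairing_lsmul_coord {Ω ι : Type*} [MeasurableSpace Ω] [Fintype ι] {μ : Measure Ω}
    (g : Lp ℂ 2 μ) (v : Lp (EuclideanSpace ℂ ι) 2 μ) (i : ι) :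
    (ContinuousLinearMap.lsmul ℂ ℂ (E := EuclideanSpace ℂ ι)).lpPairing μ 2 2 g v i =
      ∫ k, g k * v k i ∂μ := by
  have hI : Integrable (fun k => g k • v k) μ :=
    memLp_one_iff_integrable.1 ((Lp.memLp v).smul (Lp.memLp g))
  rw [ContinuousLinearMap.lpPairing_eq_integral]
  exact ((EuclideanSpace.proj i : EuclideanSpace ℂ ι →L[ℂ] ℂ).integral_comp_comm hI).symm

/-- The operator `u ↦ ∫ g u dμ` on negative energy solutions, with `μ` the measure of the scalar
product, depending linearly on `g ∈ L²(μ)`. All of the dependence of `Ψ(y)` on `y` is in the function `g`, see `waveEval_eq_superpose`. -/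
def superpose (m : ℝ) : Lp ℂ 2 (stateMeasure m) →L[ℂ] (Sea m →L[ℂ] Spinor) :=
  ContinuousLinearMap.precomp Spinor (seaSubmodule m).subtypeL ∘L
    (ContinuousLinearMap.lsmul ℂ ℂ (E := Spinor)).lpPairing (stateMeasure m) 2 2

lemma superpose_apply_eq_lpPairing (m : ℝ) (g : Lp ℂ 2 (stateMeasure m)) (u : Sea m) :
    superpose m g u = (ContinuousLinearMap.lsmul ℂ ℂ (E := Spinor)).lpPairing (stateMeasure m) 2 2 g
      (u : Lp Spinor 2 (stateMeasure m)) := rfl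

lemma superpose_apply_coord (m : ℝ) (g : Lp ℂ 2 (stateMeasure m)) (u : Sea m) (i : Fin 4) :
    superpose m g u i =
      ∫ k, g k * (u : Lp Spinor 2 (stateMeasure m)) k i ∂(stateMeasure m) :=
  lpPairing_lsmul_coord g _ i

lemma waveEval_eq_superpose {ε : ℝ} (hε : 0 < ε) (m : ℝ) (x : Spacetime) :
    waveEval hε m x = superpose m (planeWaveLp hε m x) := by
  ext1 u
  rw [waveEval_apply, waveEvalFun_eq hε, superpose_apply_eq_lpPairing]
  unfold planeWaveLp phaseLp
  congr 2
  exact MemLp.toLp_congr _ _ (Eventually.of_forall (planeWaveDensity_eq ε x))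

lemma inner_apply_eq_zero_of_basis {H ι : Type*} [NormedAddCommGroup H]
    [InnerProductSpace ℂ H] [Fintype ι] [DecidableEq ι] {n : ℕ}
    (T : ContinuousMultilinearMap ℝ (fun _ : Fin n => ι → ℝ) (Spinor →L[ℂ] H)) (φ : Spinor) (u : H)
    (hT : ∀ μ : Fin n → ι, inner ℂ (T (fun i => Pi.single (μ i) 1) φ) u = 0) (h : Fin n → ι → ℝ) :
    inner ℂ (T h φ) u = 0 := by
  let ℓ : (Spinor →L[ℂ] H) →ₗ[ℝ] ℂ :=
    { toFun := fun A => inner ℂ (A φ) u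
      map_add' := fun A B => by rw [add_apply, inner_add_left]
      map_smul' := fun c A => by
        rw [RingHom.id_apply, smul_apply, ← Complex.coe_smul c (A φ), inner_smul_left,
          Complex.conj_ofReal, Complex.real_smul] }
  have h0 : ℓ.compMultilinearMap T.toMultilinearMap = 0 := by
    refine Module.Basis.ext_multilinear (fun _ => Pi.basisFun ℝ ι) fun μ => ?_
    simp only [Pi.basisFun_apply]
    exact hT μ
  exact congrArg (fun S => S h) h0

section SpinAdjointReal

variable {H V : Type*} [NormedAddCommGroup H] [InnerProductSpace ℂ H] [CompleteSpace H]
  [NormedAddCommGroup V] [NormedSpace ℂ V] [NormedSpace ℝ V] [IsScalarTower ℝ ℂ V]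

lemma inner_spinAdjoint (A : H →L[ℂ] Spinor) (φ : Spinor) (u : H) :
    inner ℂ (spinAdjoint A φ) u =
      inner ℂ (Matrix.toEuclideanCLM (n := Fin 4) (𝕜 := ℂ) (gamma 0) φ) (A u) := by
  unfold spinAdjoint
  rw [ContinuousLinearMap.comp_apply, ContinuousLinearMap.adjoint_inner_left]

/-- The spin adjoints of a complex linear family of operators, as a bounded map of the parameter. The
adjoint is antilinear, so this map is linear over `ℝ` only. -/
def spinAdjointComp (B : V →L[ℂ] (H →L[ℂ] Spinor)) : V →L[ℝ] (Spinor →L[ℂ] H) where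
  toFun g := spinAdjoint (B g)
  map_add' f g := by simp only [spinAdjoint, map_add, ContinuousLinearMap.add_comp]
  map_smul' c g := by
    have h : c • g = (c : ℂ) • g := (algebraMap_smul ℂ c g).symm
    have h2 : ContinuousLinearMap.adjoint ((c : ℂ) • B g) =
        (c : ℂ) • ContinuousLinearMap.adjoint (B g) := by
      rw [map_smulₛₗ, Complex.conj_ofReal]
    simp only [spinAdjoint, h, map_smul, h2, ContinuousLinearMap.smul_comp, RingHom.id_apply]
    exact Complex.coe_smul c _
  cont := by
    unfold spinAdjoint
    fun_prop

lemma contDiff_spinAdjoint_comp {E : Type*} [NormedAddCommGroup E] [NormedSpace ℝ E]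
    (B : V →L[ℂ] (H →L[ℂ] Spinor)) {g : E → V} (hg : ContDiff ℝ ∞ g) :
    ContDiff ℝ ∞ fun y => spinAdjoint (B (g y)) :=
  (spinAdjointComp B).contDiff.comp hg

lemma iteratedFDeriv_spinAdjoint_comp {E : Type*} [NormedAddCommGroup E] [NormedSpace ℝ E]
    (B : V →L[ℂ] (H →L[ℂ] Spinor)) {g : E → V} (hg : ContDiff ℝ ∞ g) {n : ℕ} (x : E)
    (h : Fin n → E) :
    iteratedFDeriv ℝ n (fun y => spinAdjoint (B (g y))) x h =
      spinAdjoint (B (iteratedFDeriv ℝ n g x h)) := by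
  have h1 := (spinAdjointComp B).iteratedFDeriv_comp_left (hg.contDiffAt (x := x))
    (i := n) (by exact_mod_cast le_top)
  exact congrArg (fun T => T h) h1

end SpinAdjointReal

lemma contDiff_planeWaveLp {ε : ℝ} (hε : 0 < ε) (m : ℝ) : ContDiff ℝ ∞ (planeWaveLp hε m) :=
  contDiff_phaseLp _ _

lemma contDiff_spinAdjoint_waveEval {ε : ℝ} (hε : 0 < ε) (m : ℝ) :
    ContDiff ℝ ∞ (fun y : Spacetime => spinAdjoint (waveEval hε m y)) := by
  simp only [waveEval_eq_superpose]
  exact contDiff_spinAdjoint_comp _ (contDiff_planeWaveLp hε m)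

/-- Each derivative of `y ↦ Ψ(y)^*` in a direction `h` multiplies the plane wave by
`-i k_μ h^μ`. -/
lemma iteratedFDeriv_spinAdjoint_waveEval {ε : ℝ} (hε : 0 < ε) (m : ℝ) (x : Spacetime) {n : ℕ}
    (h : Fin n → Spacetime) :
    iteratedFDeriv ℝ n (fun y : Spacetime => spinAdjoint (waveEval hε m y)) x h =
      spinAdjoint (superpose m (phaseLp measurable_lowerIndex
        ((hasMoments_planeWaveDensity hε m 0).mul_prod measurable_lowerIndex h) x)) := by
  simp only [waveEval_eq_superpose]
  rw [← iteratedFDeriv_phaseLp]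
  exact iteratedFDeriv_spinAdjoint_comp _ (contDiff_planeWaveLp hε m) x h

/-! ### Density of the derivatives and the expansion theorem -/

lemma toEuclideanCLM_gamma_zero_surjective :
    Function.Surjective (Matrix.toEuclideanCLM (n := Fin 4) (𝕜 := ℂ) (gamma 0)) := by
  intro φ
  refine ⟨Matrix.toEuclideanCLM (n := Fin 4) (𝕜 := ℂ) (gamma 0) φ, ?_⟩
  have h : gamma 0 * gamma 0 = 1 := by
    ext i j
    fin_cases i <;> fin_cases j <;> simp [gamma, Matrix.mul_apply, Fin.sum_univ_four]
  rw [← mul_apply_eq_comp, ← map_mul, h, map_one, one_apply_eq_self]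

/-- If `u` is orthogonal to all iterated partial derivatives of `Ψ(y)^*` at `x`, then by multilinearity
it is orthogonal to the derivatives in arbitrary directions. The matrix `γ⁰` in the spin inner
product is invertible, so the corresponding moments of `u` vanish in `ℂ⁴`. -/
lemma superpose_eq_zero_of_orthogonal {ε : ℝ} (hε : 0 < ε) (m : ℝ) (x : Spacetime) (u : Sea m)
    (hu : ∀ (n : ℕ) (μ : Fin n → Fin 4) (φ : Spinor),
      inner ℂ (partialDerivsAdjoint hε m x μ φ) u = 0) {n : ℕ} (h : Fin n → Spacetime) :
    superpose m (phaseLp measurable_lowerIndex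
      ((hasMoments_planeWaveDensity hε m 0).mul_prod measurable_lowerIndex h) x) u = 0 := by
  rw [← inner_self_eq_zero (𝕜 := ℂ)]
  obtain ⟨φ, hφ⟩ := toEuclideanCLM_gamma_zero_surjective (superpose m (phaseLp measurable_lowerIndex
      ((hasMoments_planeWaveDensity hε m 0).mul_prod measurable_lowerIndex h) x) u)
  nth_rw 1 [← hφ]
  rw [← inner_spinAdjoint, ← iteratedFDeriv_spinAdjoint_waveEval]
  exact inner_apply_eq_zero_of_basis _ φ u (fun μ => hu n μ φ) h

/-- The ranges of all iterated partial derivatives of `Ψ(y)^*` at one point `x` span a dense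
subspace: only `0` is orthogonal to all of them. -/
lemma eq_zero_of_orthogonal {ε : ℝ} (hε : 0 < ε) (m : ℝ) (x : Spacetime) (u : Sea m)
    (hu : ∀ (n : ℕ) (μ : Fin n → Fin 4) (φ : Spinor),
      inner ℂ (partialDerivsAdjoint hε m x μ φ) u = 0) : u = 0 := by
  have hmem := Lp.memLp (u : Lp Spinor 2 (stateMeasure m))
  have hcomp : ∀ i : Fin 4,
      MemLp (fun k => (u : Lp Spinor 2 (stateMeasure m)) k i) 2 (stateMeasure m) := fun i =>
    (EuclideanSpace.proj i : Spinor →L[ℂ] ℂ).comp_memLp' hmem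
  -- Each component of `u`, times the plane wave density, is an exponentially decaying density
  -- all of whose moments vanish.
  have hzero : ∀ i : Fin 4, (fun k => planeWaveDensity ε x k *
      (u : Lp Spinor 2 (stateMeasure m)) k i) =ᵐ[stateMeasure m] 0 := by
    intro i
    refine ae_eq_zero_of_moments (δ := ε / 4) (by positivity) ?_ fun L n => ?_
    · have h1 : MemLp (fun k : Spacetime => (Real.exp (ε / 4 * ‖k‖) : ℂ) * planeWaveDensity ε x k)
          2 (stateMeasure m) := by
        have := measurable_planeWaveDensity ε x
        refine (memLp_planeWaveDensity (half_pos hε) m x).of_le (by fun_prop) ?_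
        filter_upwards [norm_le_neg_ae m] with k hk
        rw [norm_mul, Complex.norm_real, Real.norm_of_nonneg (Real.exp_pos _).le]
        exact exp_mul_norm_planeWaveDensity_le hε x hk
      refine (h1.integrable_mul (hcomp i)).congr (Eventually.of_forall fun k => ?_)
      simp only [Pi.mul_apply, mul_assoc]
    · -- The direction `v` in which the derivative of the plane wave produces the factor `-i L(k)`.
      let v : Spacetime := lowerIndex fun j => L (Pi.single j 1)
      have hv : ∀ k : Spacetime, lowerIndex k ⬝ᵥ v = L k := by
        intro k
        conv_rhs => rw [pi_eq_sum_univ' k, map_sum]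
        simp [v, lowerIndex, dotProduct, Fin.sum_univ_four]
      have h1 := congrArg (fun φ : Spinor => φ i)
        (superpose_eq_zero_of_orthogonal hε m x u hu (fun _ : Fin n => v))
      simp only [superpose_apply_coord, PiLp.zero_apply] at h1
      have h2 : ∫ k, (-Complex.I) ^ n * ((L k : ℂ) ^ n * (planeWaveDensity ε x k *
          (u : Lp Spinor 2 (stateMeasure m)) k i)) ∂(stateMeasure m) = 0 := by
        rw [← h1]
        refine integral_congr_ae ?_
        filter_upwards [coeFn_phaseLp measurable_lowerIndex
          ((hasMoments_planeWaveDensity hε m 0).mul_prod measurable_lowerIndex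
            (fun _ : Fin n => v)) x] with k hk
        rw [hk, planeWaveDensity_eq ε x]
        simp only [hv, Finset.prod_const, Finset.card_univ, Fintype.card_fin, mul_pow]
        ring
      rw [integral_const_mul] at h2
      exact (mul_eq_zero.1 h2).resolve_left (pow_ne_zero _ (neg_ne_zero.2 Complex.I_ne_zero))
  have hk0 : ∀ᵐ k ∂(stateMeasure m), k 0 ≠ 0 :=
    (withDensity_absolutelyContinuous _ _).ae_le (k0_ne_zero_ae m)
  apply Subtype.ext
  apply Lp.ext
  filter_upwards [ae_all_iff.2 hzero, hk0, Lp.coeFn_zero Spinor 2 (stateMeasure m)] with k h1 h2 h3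
  rw [Submodule.coe_zero, h3]
  ext i
  refine (mul_eq_zero.1 (h1 i)).resolve_left ?_
  refine norm_ne_zero_iff.1 ?_
  rw [norm_planeWaveDensity]
  have := abs_pos.2 h2
  positivity

lemma eq_zero_of_comp_partialDerivsAdjoint {ε : ℝ} (hε : 0 < ε) (m : ℝ) (x : Spacetime)
    (J : Sea m →L[ℂ] Spinor)
    (hJ : ∀ (n : ℕ) (μ : Fin n → Fin 4), J ∘L partialDerivsAdjoint hε m x μ = 0) : J = 0 := by
  -- Every vector in the range of `J†` is orthogonal to the ranges of the derivatives.
  have hadj : ContinuousLinearMap.adjoint J = 0 := by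
    ext1 χ
    refine eq_zero_of_orthogonal hε m x _ fun n μ φ => ?_
    rw [ContinuousLinearMap.adjoint_inner_right, ← ContinuousLinearMap.comp_apply, hJ n μ]
    simp
  exact ContinuousLinearMap.adjoint.map_eq_zero_iff.1 hadj

end MinkowskiCFS
end

open MinkowskiCFS
theorem mainTheorem2 {ε : ℝ} (hε : 0 < ε) {m : ℝ} (hm : 0 ≤ m) :
    ContDiff ℝ ∞ (fun y : Spacetime => spinAdjoint (waveEval hε m y)) ∧
    ∀ (r : ℝ) (p : Perturbation hε m) (x : Spacetime) (J : Sea m →L[ℂ] Spinor),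
      IsCFSCurrent r p x J →
        (J = 0 ↔
          ∀ (n : ℕ) (μ : Fin n → Fin 4), J ∘L partialDerivsAdjoint hε m x μ = 0) := by
  refine ⟨contDiff_spinAdjoint_waveEval hε m,
    fun r p x J _ => ⟨?_, eq_zero_of_comp_partialDerivsAdjoint hε m x J⟩⟩
  rintro rfl n μ
  exact ContinuousLinearMap.zero_comp _
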